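/- Let $R$ be a (not necessarily commutative) ring with unit and let $\mathcal X$ be a class of left $R$-modules. Call a left $R$-module $M$ \emph{$(\aleph_1,\mathcal X)$-free} if there is a set $\mathcal S$ of submodules of $M$, directed under inclusion, such that (1) every member of $\mathcal S$ belongs to $\mathcal X$; (2) $\mathcal S$ is closed under unions of nonempty well-ordered chains of length ${<}\aleph_1$; (3) every subset of $M$ of cardinality ${<}\aleph_1$ is contained in a member of $\mathcal S$. Suppose that $\mathcal X$ is closed under (i) $\aleph_1$-free modules, i.e. every $(\aleph_1,\mathcal X)$-free module belongs to $\mathcal X$; (ii) direct sums of arbitrary families of modules; and (iii) direct summands, i.e. every module isomorphic to a direct summand of a member of $\mathcal X$ belongs to $\mathcal X$. An \emph{$\mathcal X$-precover} of a module $M$ is a homomorphism $f\colon X\to M$ with $X\in\mathcal X$ such that for every $Y\in\mathcal X$ each homomorphism $Y\to M$ factors through $f$; it is an \emph{$\mathcal X$-cover} if moreover every endomorphism $g$ of $X$ with $f\circ g=f$ is an automorphism. The class $\mathcal X$ is \emph{precovering} (resp. \emph{covering}) if every left $R$-module has an $\mathcal X$-precover (resp. an $\mathcal X$-cover). Then (in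 ZFC, without additional set-theoretic assumptions): if $\mathcal X$ is precovering, then $\mathcal X$ is closed under direct limits, i.e. the direct limit of every direct system of modules in $\mathcal X$ indexed by a (nonempty) directed partially ordered set belongs to $\mathcal X$. In particular, Enochs' conjecture holds for $\mathcal X$: if $\mathcal X$ is covering, then $\mathcal X$ is closed under direct limits. -/

import Mathlib

open scoped DirectSum Cardinal

universe u v

namespace ModuleClass

variable {R : Type u} [Ring R]

/-- A class of left `R`-modules, given as a predicate on the modules of the universe `v`. -/
abbrev _root_.ModuleClass (R : Type u) [Ring R] := ModuleCat.{v} R → Prop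

/-- A `(κ, 𝒳)`-dense system of submodules of `M`. It is used for an uncountable regular
cardinal `κ`. A well-ordered chain of length `< κ` is a monotone family of members of `S`
indexed by a nonempty well-ordered type of cardinality `< κ`; the supremum of such a chain
of submodules is its union. -/
structure IsDenseSystem (κ : Cardinal.{v}) (𝒳 : ModuleClass.{u, v} R) (M : ModuleCat.{v} R)
    (S : Set (Submodule R M)) : Prop where
  directed : DirectedOn (· ≤ ·) S
  mem_class : ∀ N ∈ S, 𝒳 (ModuleCat.of R N)
  union_mem : ∀ (ι : Type v) [LinearOrder ι] [WellFoundedLT ι] [Nonempty ι], #ι < κ →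
    ∀ c : ι → Submodule R M, Monotone c → (∀ i, c i ∈ S) → (⨆ i, c i) ∈ S
  exists_le : ∀ Y : Set M, #Y < κ → ∃ N ∈ S, Y ⊆ (N : Set M)

/-- `M` is `(κ, 𝒳)`-free. -/
def IsFreeRel (κ : Cardinal.{v}) (𝒳 : ModuleClass.{u, v} R) (M : ModuleCat.{v} R) : Prop :=
  ∃ S : Set (Submodule R M), IsDenseSystem κ 𝒳 M S

/-- `𝒳` is closed under `κ`-free modules: every `(κ, 𝒳)`-free module belongs to `𝒳`. -/
def ClosedUnderFree (κ : Cardinal.{v}) (𝒳 : ModuleClass.{u, v} R) : Prop :=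
  ∀ M : ModuleCat.{v} R, IsFreeRel κ 𝒳 M → 𝒳 M

/-- `𝒳` is closed under (arbitrary set-indexed) direct sums. -/
def ClosedUnderDirectSums (𝒳 : ModuleClass.{u, v} R) : Prop :=
  ∀ (ι : Type v) (F : ι → ModuleCat.{v} R), (∀ i, 𝒳 (F i)) →
    𝒳 (ModuleCat.of R (⨁ i, F i))

/-- `𝒳` is closed under direct summands: a module `N` that is isomorphic to a direct summand
of some `M` in `𝒳` (that is, `N` has an injection into `M` with a linear retraction) is in `𝒳`.
In particular `𝒳` is closed under isomorphism. -/
def ClosedUnderDirectSummands (𝒳 : ModuleClass.{u, v} R) : Prop :=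
  ∀ (M N : ModuleCat.{v} R), 𝒳 M →
    ∀ (i : N →ₗ[R] M) (p : M →ₗ[R] N), p ∘ₗ i = LinearMap.id → 𝒳 N

open Classical in
/-- `𝒳` is closed under direct limits of direct systems indexed by nonempty directed posets. -/
def ClosedUnderDirectLimits (𝒳 : ModuleClass.{u, v} R) : Prop :=
  ∀ (ι : Type v) [PartialOrder ι] [IsDirectedOrder ι] [Nonempty ι]
    (F : ι → ModuleCat.{v} R) (f : ∀ i j, i ≤ j → F i →ₗ[R] F j)
    [DirectedSystem (fun i => F i) fun i j h => f i j h],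
    (∀ i, 𝒳 (F i)) → 𝒳 (ModuleCat.of R (Module.DirectLimit (fun i => F i) f))

/-- `f : X → M` is an `𝒳`-precover of `M`. -/
def IsPrecover (𝒳 : ModuleClass.{u, v} R) {X M : ModuleCat.{v} R} (f : X →ₗ[R] M) : Prop :=
  𝒳 X ∧ ∀ Y : ModuleCat.{v} R, 𝒳 Y → ∀ g : Y →ₗ[R] M, ∃ h : Y →ₗ[R] X, f ∘ₗ h = g

/-- `f : X → M` is an `𝒳`-cover of `M`. -/
def IsCover (𝒳 : ModuleClass.{u, v} R) {X M : ModuleCat.{v} R} (f : X →ₗ[R] M) : Prop :=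
  IsPrecover 𝒳 f ∧ ∀ g : X →ₗ[R] X, f ∘ₗ g = f → Function.Bijective g

/-- Every module has an `𝒳`-precover. -/
def Precovering (𝒳 : ModuleClass.{u, v} R) : Prop :=
  ∀ M : ModuleCat.{v} R, ∃ (X : ModuleCat.{v} R) (f : X →ₗ[R] M), IsPrecover 𝒳 f

/-- Every module has an `𝒳`-cover. -/
def Covering (𝒳 : ModuleClass.{u, v} R) : Prop :=
  ∀ M : ModuleCat.{v} R, ∃ (X : ModuleCat.{v} R) (f : X →ₗ[R] M), IsCover 𝒳 f

end ModuleClass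

namespace ModuleClass

/-! For a well-ordered system without last index and with limit `C`, the heart is that an
`𝒳`-precover `π : X → C` splits. Take points `A` placed at levels in `ι`; branches are the subsets
of `A`, and a node is the part of a branch below some level. The tree module is generated by the
sections that start at an element of `F i` and follow a branch upwards. Countably many branches span
a direct sum of modules `F i` (`branchSpan_mem_class`), so the tree module is `(ℵ₁, 𝒳)`-free and
lies in `𝒳`.

Each set `S` of branches defines a map to `C`, canonical on branches in `S` and zero on the others
(`exists_treeModule_map`); it lifts through `π`. There are `2 ^ 2 ^ #A` such `S`, but a section cut
off at some level depends only on a node, and there are at most `#A` of these truncated sections.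
Hence the lifts for two different sets agree on all of them. Along a branch in just one of the two
sets, the difference of the lifts is compatible with the system and, up to sign, splits `π`
(`chain_limit_mem`).

Arbitrary directed posets follow by induction on cardinality (`directed_limit_mem`). -/

theorem toModule_eq_sum_support {R : Type*} [Ring R] {ι : Type*} {F : ι → Type*} {N : Type*}
    [∀ i, AddCommGroup (F i)] [∀ i, Module R (F i)] [AddCommGroup N] [Module R N]
    [DecidableEq ι] [∀ i (x : F i), Decidable (x ≠ 0)] (φ : ∀ i, F i →ₗ[R] N) (x : ⨁ i, F i) :
    DirectSum.toModule R ι N φ x = ∑ i ∈ DFinsupp.support x, φ i (x i) := by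
  conv_lhs => rw [← DirectSum.sum_support_of x]
  rw [map_sum]
  refine Finset.sum_congr rfl fun i _ => ?_
  rw [← DirectSum.lof_eq_of R, DirectSum.toModule_lof]

/-! ### Tree modules and their `ℵ₁`-freeness. -/

section TreeModule

variable {R : Type u} [Ring R] {ι : Type v} [LinearOrder ι] {F : ι → ModuleCat.{v} R}
  (f : ∀ i j, i ≤ j → F i →ₗ[R] F j) {A : Type v} (l : A → ι)

/-- The node of level `i` on the branch `b`. -/
def node (b : Set A) (i : ι) : Set A := {a | a ∈ b ∧ l a < i}

theorem node_eq_of_le {b b' : Set A} {i j : ι} (hij : i ≤ j) (h : node l b j = node l b' j) :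
    node l b i = node l b' i := by
  ext a
  have := Set.ext_iff.1 h a
  simp only [node, Set.mem_ofPred_eq] at this ⊢
  constructor <;> rintro ⟨h1, h2⟩ <;> have := h2.trans_le hij <;> tauto

theorem exists_node_ne [NoMaxOrder ι] {b b' : Set A} (h : b ≠ b') :
    ∃ i, node l b i ≠ node l b' i := by
  by_contra! H
  refine h (Set.ext fun a => ?_)
  obtain ⟨i, hi⟩ := exists_gt (l a)
  simpa [node, hi] using Set.ext_iff.1 (H i) a

open Classical in
/-- The section over the nodes of a branch which starts with a given element at a given level. -/
noncomputable def branchMap (p : Set A × ι) : F p.2 →ₗ[R] (∀ q : ι × Set A, F q.1) :=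
  LinearMap.pi fun q => if h : p.2 ≤ q.1 ∧ q.2 = node l p.1 q.1 then f p.2 q.1 h.1 else 0

theorem branchMap_of_pos {p : Set A × ι} {q : ι × Set A} (h : p.2 ≤ q.1)
    (h' : q.2 = node l p.1 q.1) (y : F p.2) : branchMap f l p y q = f p.2 q.1 h y := by
  simp [branchMap, h, h']

theorem branchMap_of_neg {p : Set A × ι} {q : ι × Set A}
    (h : ¬ (p.2 ≤ q.1 ∧ q.2 = node l p.1 q.1)) (y : F p.2) : branchMap f l p y q = 0 := by
  simp [branchMap, h]

open Classical in
/-- The map from the free part whose image is the tree module. -/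
noncomputable def treeMap : (⨁ p : Set A × ι, F p.2) →ₗ[R] (∀ q : ι × Set A, F q.1) :=
  DirectSum.toModule R _ _ (branchMap f l)

/-- The tree module of a well-ordered direct system. -/
abbrev TreeModule : Type v := (⨁ p : Set A × ι, F p.2) ⧸ LinearMap.ker (treeMap f l)

open Classical in
/-- The canonical map of a member of the system to the tree module along a branch. -/
noncomputable def treeIncl (p : Set A × ι) : F p.2 →ₗ[R] TreeModule f l :=
  (LinearMap.ker (treeMap f l)).mkQ ∘ₗ DirectSum.lof R _ (fun p : Set A × ι => F p.2) p

/-- The embedding of the tree module into the product over the nodes. -/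
noncomputable def treeEmb : TreeModule f l →ₗ[R] (∀ q : ι × Set A, F q.1) :=
  (LinearMap.ker (treeMap f l)).liftQ (treeMap f l) le_rfl

theorem treeEmb_injective : Function.Injective (treeEmb f l) :=
  LinearMap.ker_eq_bot.1 (Submodule.ker_liftQ_eq_bot' _ _ rfl)

@[simp] theorem treeEmb_treeIncl (p : Set A × ι) (y : F p.2) :
    treeEmb f l (treeIncl f l p y) = branchMap f l p y := by
  classical
  exact DirectSum.toModule_lof (φ := branchMap f l) R p y

/-- The difference of the sections starting at two levels depends only on the nodes between them,
and not on the branch. -/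
theorem treeIncl_sub_eq [DirectedSystem (fun i => F i) fun i j h => f i j h]
    {b b' : Set A} {i j : ι} (hij : i ≤ j)
    (h : ∀ k < j, node l b k = node l b' k) (y : F i) :
    treeIncl f l (b, i) y - treeIncl f l (b, j) (f i j hij y) =
      treeIncl f l (b', i) y - treeIncl f l (b', j) (f i j hij y) := by
  apply treeEmb_injective
  simp only [map_sub, treeEmb_treeIncl]
  -- From level `j` on the two sections cancel, so nodes need only agree strictly below `j`.
  have key : ∀ (c : Set A) (q : ι × Set A), j ≤ q.1 →
      branchMap f l (c, i) y q - branchMap f l (c, j) (f i j hij y) q = 0 := by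
    intro c q hq
    by_cases hc : q.2 = node l c q.1
    · rw [branchMap_of_pos f l (p := (c, i)) (hij.trans hq) hc,
        branchMap_of_pos f l (p := (c, j)) hq hc]
      rw [DirectedSystem.map_map' (f := f), sub_self]
    · rw [branchMap_of_neg f l (p := (c, i)) (by tauto),
        branchMap_of_neg f l (p := (c, j)) (by tauto), sub_self]
  funext q
  simp only [Pi.sub_apply]
  rcases le_or_gt j q.1 with hq | hq
  · rw [key b q hq, key b' q hq]
  · have hn := h _ hq
    rw [branchMap_of_neg f l (p := (b, j)) (fun h => hq.not_ge h.1),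
      branchMap_of_neg f l (p := (b', j)) (fun h => hq.not_ge h.1)]
    congr 1
    by_cases hc : i ≤ q.1 ∧ q.2 = node l b q.1
    · rw [branchMap_of_pos f l (p := (b, i)) hc.1 hc.2,
        branchMap_of_pos f l (p := (b', i)) hc.1 (hc.2.trans hn)]
    · rw [branchMap_of_neg f l (p := (b, i)) hc,
        branchMap_of_neg f l (p := (b', i)) (by rw [← hn]; exact hc)]

/-- The submodule of the tree module spanned by a set of branches. -/
noncomputable def branchSpan (B : Set (Set A)) : Submodule R (TreeModule f l) :=
  ⨆ b ∈ B, ⨆ i, LinearMap.range (treeIncl f l (b, i))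

theorem treeIncl_mem_branchSpan {B : Set (Set A)} {b : Set A} (hb : b ∈ B) (i : ι) (y : F i) :
    treeIncl f l (b, i) y ∈ branchSpan f l B :=
  Submodule.mem_iSup_of_mem b <| Submodule.mem_iSup_of_mem hb <| Submodule.mem_iSup_of_mem i
    ⟨y, rfl⟩

theorem branchSpan_le {B : Set (Set A)} {N : Submodule R (TreeModule f l)}
    (h : ∀ b ∈ B, ∀ i (y : F i), treeIncl f l (b, i) y ∈ N) : branchSpan f l B ≤ N := by
  refine iSup₂_le fun b hb => iSup_le fun i => ?_
  rintro _ ⟨y, rfl⟩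
  exact h b hb i y

theorem branchSpan_mono {B B' : Set (Set A)} (h : B ⊆ B') :
    branchSpan f l B ≤ branchSpan f l B' :=
  biSup_mono h

theorem branchSpan_iUnion {J : Type*} (B : J → Set (Set A)) :
    branchSpan f l (⋃ j, B j) = ⨆ j, branchSpan f l (B j) := by
  refine le_antisymm (branchSpan_le f l fun b hb i y => ?_)
    (iSup_le fun j => branchSpan_mono f l (Set.subset_iUnion B j))
  obtain ⟨j, hj⟩ := Set.mem_iUnion.1 hb
  exact Submodule.mem_iSup_of_mem j (treeIncl_mem_branchSpan f l hj i y)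

theorem exists_finset_mem_branchSpan (x : TreeModule f l) :
    ∃ B : Finset (Set A), x ∈ branchSpan f l (B : Set (Set A)) := by
  classical
  obtain ⟨x, rfl⟩ := Submodule.mkQ_surjective _ x
  refine ⟨(DFinsupp.support x).image Prod.fst, ?_⟩
  suffices h : (LinearMap.ker (treeMap f l)).mkQ
      (∑ p ∈ DFinsupp.support x, DirectSum.of (fun p : Set A × ι => F p.2) p (x p)) ∈
      branchSpan f l ((DFinsupp.support x).image Prod.fst : Finset (Set A)) by
    rwa [DirectSum.sum_support_of] at h
  rw [map_sum]
  refine Submodule.sum_mem _ fun p hp => ?_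
  exact treeIncl_mem_branchSpan f l
    (Finset.mem_coe.2 (Finset.mem_image_of_mem Prod.fst hp)) p.2 (x p)

/-- The starting points on the branches in `B` that are new with respect to the earlier branches
in the enumeration `n`. -/
def newPairs (n : Set A → ℕ) (B : Set (Set A)) : Set (Set A × ι) :=
  {p | p.1 ∈ B ∧ ∀ b ∈ B, n b < n p.1 → node l p.1 p.2 ≠ node l b p.2}

/-- Induction along the enumeration: a section that is not new follows an earlier branch until `b`
has left every earlier one. The truncated piece lies on that earlier branch, and the remainder
starts at a new pair. -/
theorem treeIncl_mem_newPairs [DirectedSystem (fun i => F i) fun i j h => f i j h]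
    [WellFoundedLT ι] [NoMaxOrder ι] {n : Set A → ℕ} {B : Set (Set A)}
    (hn : Set.InjOn n B) (N : Submodule R (TreeModule f l))
    (hN : ∀ p ∈ newPairs l n B, ∀ y, treeIncl f l p y ∈ N) :
    ∀ b ∈ B, ∀ i (y : F i), treeIncl f l (b, i) y ∈ N := by
  classical
  suffices H : ∀ m : ℕ, ∀ b ∈ B, n b = m → ∀ i (y : F i), treeIncl f l (b, i) y ∈ N from
    fun b hb => H _ b hb rfl
  intro m
  induction m using Nat.strong_induction_on with
  | _ m ih =>
    rintro b hb rfl i y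
    by_cases hp : (b, i) ∈ newPairs l n B
    · exact hN _ hp y
    have hfin : {c | c ∈ B ∧ n c < n b}.Finite :=
      Set.Finite.of_finite_image ((Set.finite_Iio (n b)).subset (by rintro _ ⟨c, hc, rfl⟩; exact hc.2))
        (hn.mono fun c hc => hc.1)
    simp only [newPairs, Set.mem_ofPred_eq, not_and, not_forall, not_not] at hp
    obtain ⟨c₀, hc₀, hlt₀, heq₀⟩ := hp hb
    have hne : ∀ c, n c < n b → ∃ j, node l b j ≠ node l c j := fun c hc =>
      exists_node_ne l (by rintro rfl; exact lt_irrefl _ hc)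
    -- The first level at which `c` separates from `b`; the default `i` is never used, since only
    -- earlier `c` occur.
    let δ : Set A → ι := fun c =>
      if h : n c < n b then wellFounded_lt.min {j | node l b j ≠ node l c j} (hne c h) else i
    have hδ : ∀ c, n c < n b → node l b (δ c) ≠ node l c (δ c) := by
      intro c hc
      simp only [δ, dif_pos hc]
      exact wellFounded_lt.min_mem {j | node l b j ≠ node l c j} (hne c hc)
    have hδ' : ∀ c, n c < n b → ∀ j < δ c, node l b j = node l c j := by
      intro c hc j hj
      by_contra hj'
      simp only [δ, dif_pos hc] at hj
      exact wellFounded_lt.not_lt_min {j | node l b j ≠ node l c j} hj' hj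
    -- The earlier branch that stays with `b` longest: at its splitting level `b` differs from all
    -- earlier branches.
    obtain ⟨c, hc, hmax⟩ := hfin.toFinset.exists_max_image δ ⟨c₀, by simp [hc₀, hlt₀]⟩
    simp only [Set.Finite.mem_toFinset, Set.mem_ofPred_eq] at hc hmax
    have hnew : (b, δ c) ∈ newPairs l n B := by
      refine ⟨hb, fun c' hc' hlt => fun h => hδ c' hlt ?_⟩
      exact node_eq_of_le l (hmax c' ⟨hc', hlt⟩) h
    have hi : i < δ c := by
      by_contra! hle
      exact hδ c₀ hlt₀ (node_eq_of_le l ((hmax c₀ ⟨hc₀, hlt₀⟩).trans hle) heq₀)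
    have hsub := treeIncl_sub_eq f l hi.le (hδ' c hc.2) y
    have hmem : treeIncl f l (b, i) y - treeIncl f l (b, δ c) (f i (δ c) hi.le y) ∈ N := by
      rw [hsub]
      exact N.sub_mem (ih _ hc.2 c hc.1 rfl _ _) (ih _ hc.2 c hc.1 rfl _ _)
    simpa using N.add_mem hmem (hN _ hnew (f i (δ c) hi.le y))

/-- The sections at the new pairs are independent. -/
theorem toModule_newPairs_injective [DirectedSystem (fun i => F i) fun i j h => f i j h]
    {n : Set A → ℕ} {B : Set (Set A)} (hn : Set.InjOn n B) [DecidableEq (newPairs l n B)] :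
    Function.Injective (DirectSum.toModule R (newPairs l n B) (TreeModule f l)
      (fun p : newPairs l n B => treeIncl f l p.1)) := by
  classical
  rw [← LinearMap.ker_eq_bot, LinearMap.ker_eq_bot']
  intro x hx
  by_contra hx0
  rw [toModule_eq_sum_support] at hx
  -- Evaluate at the starting node of a term of lowest level. Another term contributes there only if
  -- it starts at the same node, and then the later of the two is not new.
  obtain ⟨p, hp, hmin⟩ := (DFinsupp.support x).exists_min_image (fun p => p.1.2)
    (by rw [Finset.nonempty_iff_ne_empty]; simpa using hx0)
  have hev := congrFun (congrArg (treeEmb f l) hx) (p.1.2, node l p.1.1 p.1.2)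
  rw [map_sum, Finset.sum_apply, Finset.sum_eq_single p] at hev
  · rw [treeEmb_treeIncl, branchMap_of_pos f l (p := p.1) le_rfl rfl] at hev
    rw [DirectedSystem.map_self' (f := f), map_zero, Pi.zero_apply] at hev
    exact (DFinsupp.mem_support_iff.1 hp) hev
  · intro q hq hqp
    rw [treeEmb_treeIncl, branchMap_of_neg]
    rintro ⟨hle, heq⟩
    obtain ⟨⟨q1, q2⟩, hqB⟩ := q
    obtain ⟨⟨p1, p2⟩, hpB⟩ := p
    have h2 : q2 = p2 := le_antisymm hle (hmin _ hq)
    subst h2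
    simp only at heq
    rcases lt_trichotomy (n q1) (n p1) with h | h | h
    · exact hpB.2 _ hqB.1 h heq
    · exact hqp (by simpa using hn hqB.1 hpB.1 h)
    · exact hqB.2 _ hpB.1 h heq.symm
  · exact fun h => (h hp).elim

theorem mem_of_linearEquiv {𝒳 : ModuleClass.{u, v} R} (hsummand : ClosedUnderDirectSummands 𝒳)
    {M N : ModuleCat.{v} R} (e : M ≃ₗ[R] N) (hM : 𝒳 M) : 𝒳 N :=
  hsummand M N hM e.symm.toLinearMap e.toLinearMap (by ext; simp)

theorem branchSpan_mem_class {𝒳 : ModuleClass.{u, v} R} (hsum : ClosedUnderDirectSums 𝒳)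
    (hsummand : ClosedUnderDirectSummands 𝒳) [WellFoundedLT ι] [NoMaxOrder ι]
    [DirectedSystem (fun i => F i) fun i j h => f i j h]
    (hF : ∀ i, 𝒳 (F i)) {B : Set (Set A)} (hB : B.Countable) :
    𝒳 (ModuleCat.of R (branchSpan f l B)) := by
  classical
  obtain ⟨n, hn⟩ := Set.countable_iff_exists_injOn.1 hB
  let φ := DirectSum.toModule R (newPairs l n B) (TreeModule f l)
      (fun p : newPairs l n B => treeIncl f l p.1)
  have hφ : Function.Injective φ := toModule_newPairs_injective f l hn
  have hrange : LinearMap.range φ = branchSpan f l B := by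
    apply le_antisymm
    · rintro _ ⟨x, rfl⟩
      simp only [φ, toModule_eq_sum_support]
      exact Submodule.sum_mem _ fun p _ => treeIncl_mem_branchSpan f l p.2.1 _ _
    · refine branchSpan_le f l (treeIncl_mem_newPairs f l hn _ fun p hp y => ?_)
      exact ⟨DirectSum.lof R _ (fun p : newPairs l n B => F p.1.2) ⟨p, hp⟩ y,
        DirectSum.toModule_lof (φ := fun p : newPairs l n B => treeIncl f l p.1) R ⟨p, hp⟩ y⟩
  let e := (LinearEquiv.ofInjective φ hφ).trans (LinearEquiv.ofEq _ _ hrange)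
  exact mem_of_linearEquiv (M := ModuleCat.of R (⨁ p : newPairs l n B, F p.1.2)) hsummand e
    (hsum _ (fun p : newPairs l n B => F p.1.2) fun p => hF _)

/-- The spans of countable sets of branches form the dense system: spans commute with unions, and
each element involves finitely many branches. -/
theorem treeModule_isFreeRel {𝒳 : ModuleClass.{u, v} R} (hsum : ClosedUnderDirectSums 𝒳)
    (hsummand : ClosedUnderDirectSummands 𝒳) [WellFoundedLT ι] [NoMaxOrder ι]
    [DirectedSystem (fun i => F i) fun i j h => f i j h] (hF : ∀ i, 𝒳 (F i)) :
    IsFreeRel (Cardinal.aleph 1) 𝒳 (ModuleCat.of R (TreeModule f l)) := by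
  refine ⟨{N | ∃ B : Set (Set A), B.Countable ∧ branchSpan f l B = N}, ?_, ?_, ?_, ?_⟩
  · rintro _ ⟨B, hB, rfl⟩ _ ⟨B', hB', rfl⟩
    exact ⟨_, ⟨B ∪ B', hB.union hB', rfl⟩, branchSpan_mono f l Set.subset_union_left,
      branchSpan_mono f l Set.subset_union_right⟩
  · rintro _ ⟨B, hB, rfl⟩
    exact branchSpan_mem_class f l hsum hsummand hF hB
  · intro J _ _ _ hJ c _ hc
    have : Countable J := by
      rw [← Cardinal.mk_le_aleph0_iff]; exact Cardinal.lt_aleph_one_iff.1 hJ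
    choose B hB hBc using hc
    refine ⟨⋃ j, B j, Set.countable_iUnion hB, ?_⟩
    rw [branchSpan_iUnion]
    exact iSup_congr hBc
  · intro Y hY
    have hY : Y.Countable :=
      Cardinal.le_aleph0_iff_set_countable.1 (Cardinal.lt_aleph_one_iff.1 hY)
    choose B hB using exists_finset_mem_branchSpan f l
    refine ⟨_, ⟨⋃ y ∈ Y, B y, hY.biUnion fun y _ => (B y).countable_toSet, rfl⟩, fun y hy => ?_⟩
    exact branchSpan_mono f l (Set.subset_biUnion_of_mem (u := fun y => (B y : Set (Set A))) hy)
      (hB y)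

end TreeModule
-- Recognising direct limits.
/-- The cocone `g` exhibits `C` as a direct limit of the direct system `f`. -/
structure IsLimitCocone {R : Type u} [Ring R] {ι : Type v} [Preorder ι] {F : ι → ModuleCat.{v} R}
    (f : ∀ i j, i ≤ j → F i →ₗ[R] F j) {C : ModuleCat.{v} R} (g : ∀ i, F i →ₗ[R] C) : Prop where
  comp : ∀ i j (h : i ≤ j) x, g j (f i j h x) = g i x
  surj : ∀ c, ∃ i x, g i x = c
  exact : ∀ i x, g i x = 0 → ∃ j, ∃ h : i ≤ j, f i j h x = 0

namespace IsLimitCocone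

variable {R : Type u} [Ring R] {ι : Type v} [PartialOrder ι] {F : ι → ModuleCat.{v} R}
  {f : ∀ i j, i ≤ j → F i →ₗ[R] F j} {C : ModuleCat.{v} R} {g : ∀ i, F i →ₗ[R] C}

theorem directLimit [IsDirectedOrder ι] [Nonempty ι] [DecidableEq ι]
    [DirectedSystem (fun i => F i) fun i j h => f i j h] :
    IsLimitCocone (C := ModuleCat.of R (Module.DirectLimit (fun i => F i) f)) f
      (Module.DirectLimit.of R ι (fun i => F i) f) where
  comp _ _ _ _ := Module.DirectLimit.of_f
  surj := Module.DirectLimit.exists_of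
  exact _ _ h := Module.DirectLimit.of.zero_exact h

theorem exists_equiv [IsDirectedOrder ι] [Nonempty ι] [DecidableEq ι] (hg : IsLimitCocone f g) :
    ∃ e : Module.DirectLimit (fun i => F i) f ≃ₗ[R] C,
      ∀ i x, e (Module.DirectLimit.of R ι (fun i => F i) f i x) = g i x := by
  refine ⟨LinearEquiv.ofBijective (Module.DirectLimit.lift R ι (fun i => F i) f g hg.comp)
    ⟨?_, fun c => ?_⟩, fun i x => ?_⟩
  · rw [← LinearMap.ker_eq_bot, LinearMap.ker_eq_bot']
    intro z hz
    obtain ⟨i, x, rfl⟩ := Module.DirectLimit.exists_of z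
    rw [Module.DirectLimit.lift_of] at hz
    obtain ⟨j, h, hj⟩ := hg.exact i x hz
    rw [← Module.DirectLimit.of_f (hij := h), hj, map_zero]
  · obtain ⟨i, x, rfl⟩ := hg.surj c
    exact ⟨_, Module.DirectLimit.lift_of ..⟩
  · exact Module.DirectLimit.lift_of g hg.comp x

theorem exists_desc [IsDirectedOrder ι] [Nonempty ι] (hg : IsLimitCocone f g) {N : Type*}
    [AddCommGroup N] [Module R N] (k : ∀ i, F i →ₗ[R] N)
    (hk : ∀ i j (h : i ≤ j) x, k j (f i j h x) = k i x) :
    ∃ t : C →ₗ[R] N, ∀ i x, t (g i x) = k i x := by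
  classical
  obtain ⟨e, he⟩ := hg.exists_equiv
  refine ⟨Module.DirectLimit.lift R ι (fun i => F i) f k hk ∘ₗ e.symm.toLinearMap, fun i x => ?_⟩
  rw [← he]
  simp

theorem mem_of_top {𝒳 : ModuleClass.{u, v} R} (hsummand : ClosedUnderDirectSummands 𝒳)
    [DirectedSystem (fun i => F i) fun i j h => f i j h] (hg : IsLimitCocone f g) {m : ι}
    (hm : ∀ i, i ≤ m) (hF : 𝒳 (F m)) : 𝒳 C := by
  refine mem_of_linearEquiv hsummand (LinearEquiv.ofBijective (g m) ⟨?_, fun c => ?_⟩) hF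
  · rw [← LinearMap.ker_eq_bot, LinearMap.ker_eq_bot']
    intro x hx
    obtain ⟨j, h, hj⟩ := hg.exact m x hx
    obtain rfl : m = j := le_antisymm h (hm j)
    rwa [DirectedSystem.map_self' (f := f)] at hj
  · obtain ⟨i, x, rfl⟩ := hg.surj c
    exact ⟨_, hg.comp i m (hm i) x⟩

end IsLimitCocone

/-! ### The counting argument for well-ordered systems. -/

section Counting

/-- There are level sets over a well-order such that the number of nodes of each level does not
exceed the number of all points. -/
theorem exists_levels (ι : Type v) [LinearOrder ι] [WellFoundedLT ι] [Nonempty ι]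
    (κ : Cardinal.{v}) :
    ∃ (A : Type v) (l : A → ι), κ ≤ #A ∧ ∀ i, #(Set {a // l a < i}) ≤ #A := by
  -- The recursive size of each level dominates the power set of all points below it, that is, the
  -- set of nodes there.
  let c : ι → Cardinal.{v} := wellFounded_lt.fix
    fun i ih => max κ (2 ^ Cardinal.sum fun j : {j // j < i} => ih j j.2)
  have hc : ∀ i, c i = max κ (2 ^ Cardinal.sum fun j : {j // j < i} => c j) := fun i =>
    wellFounded_lt.fix_eq _ i
  have hle : ∀ i, c i ≤ #(Σ i, (c i).out) := fun i => by
    rw [Cardinal.mk_sigma]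
    simpa using Cardinal.le_sum c i
  refine ⟨Σ i, (c i).out, Sigma.fst, ?_, fun i => ?_⟩
  · obtain ⟨i⟩ := ‹Nonempty ι›
    exact ((le_max_left _ _).trans_eq (hc i).symm).trans (hle i)
  · refine le_trans ?_ (hle i)
    have e : {a : Σ i, (c i).out // a.1 < i} ≃ Σ j : {j // j < i}, (c j).out :=
      { toFun := fun a => ⟨⟨a.1.1, a.2⟩, a.1.2⟩
        invFun := fun a => ⟨⟨a.1.1, a.2⟩, a.1.2⟩ }
    rw [Cardinal.mk_set, Cardinal.mk_congr e, Cardinal.mk_sigma, hc i]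
    simp

variable {R : Type u} [Ring R] {ι : Type v} [LinearOrder ι] {F : ι → ModuleCat.{v} R}
  (f : ∀ i j, i ≤ j → F i →ₗ[R] F j) {A : Type v} (l : A → ι)

open Classical in
/-- If an element of the free part vanishes in the tree module, then its part on each branch
vanishes in the direct limit. -/
theorem sum_branch_eq_zero [NoMaxOrder ι] [Nonempty ι]
    [DirectedSystem (fun i => F i) fun i j h => f i j h]
    {C : ModuleCat.{v} R} {g : ∀ i, F i →ₗ[R] C} (hg : IsLimitCocone f g)
    {x : ⨁ p : Set A × ι, F p.2} (hx : treeMap f l x = 0) (b : Set A) :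
    ∑ p ∈ DFinsupp.support x with p.1 = b, g p.2 (x p) = 0 := by
  have hlev : ∀ p : Set A × ι, ∃ i, p.1 ≠ b → node l p.1 i ≠ node l b i := fun p => by
    by_cases hp : p.1 = b
    · exact ⟨p.2, fun h => (h hp).elim⟩
    · obtain ⟨i, hi⟩ := exists_node_ne l hp
      exact ⟨i, fun _ => hi⟩
  choose lev hlev using hlev
  obtain ⟨i₁, hi₁⟩ := ((DFinsupp.support x).image Prod.snd).exists_le
  obtain ⟨i₂, hi₂⟩ := ((DFinsupp.support x).image lev).exists_le
  -- Above all starting levels and all splittings from `b`, the coordinate at the node of `b` sees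
  -- exactly the terms on `b`.
  let i := max i₁ i₂
  have h1 : ∀ p ∈ DFinsupp.support x, p.2 ≤ i := fun p hp =>
    (hi₁ _ (Finset.mem_image_of_mem _ hp)).trans (le_max_left _ _)
  have h2 : ∀ p ∈ DFinsupp.support x, p.1 ≠ b → node l p.1 i ≠ node l b i := fun p hp hpb h =>
    hlev p hpb (node_eq_of_le l
      ((hi₂ _ (Finset.mem_image_of_mem _ hp)).trans (le_max_right _ _)) h)
  have hev := congrArg (g i) (congrFun hx (i, node l b i))
  rw [treeMap, toModule_eq_sum_support, Finset.sum_apply, map_sum, Pi.zero_apply, map_zero] at hev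
  rw [Finset.sum_filter]
  refine Eq.trans ?_ hev
  refine Finset.sum_congr rfl fun p hp => ?_
  split_ifs with hpb
  · rw [branchMap_of_pos f l (h1 p hp) (by rw [hpb]), hg.comp]
  · rw [branchMap_of_neg f l (fun h => h2 p hp hpb h.2.symm), map_zero]

/-- By `sum_branch_eq_zero` each branch contributes to `C` independently, so branches can be
switched on or off at will. -/
theorem exists_treeModule_map [NoMaxOrder ι] [Nonempty ι]
    [DirectedSystem (fun i => F i) fun i j h => f i j h]
    {C : ModuleCat.{v} R} {g : ∀ i, F i →ₗ[R] C} (hg : IsLimitCocone f g) (S : Set (Set A)) :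
    ∃ t : TreeModule f l →ₗ[R] C, (∀ b ∈ S, ∀ i y, t (treeIncl f l (b, i) y) = g i y) ∧
      ∀ b ∉ S, ∀ i y, t (treeIncl f l (b, i) y) = 0 := by
  classical
  let φ : (⨁ p : Set A × ι, F p.2) →ₗ[R] C :=
    DirectSum.toModule R _ _ fun p => if p.1 ∈ S then g p.2 else 0
  have hφ : LinearMap.ker (treeMap f l) ≤ LinearMap.ker φ := by
    intro x hx
    rw [LinearMap.mem_ker] at hx ⊢
    simp only [φ, toModule_eq_sum_support]
    rw [← Finset.sum_fiberwise_of_maps_to (t := (DFinsupp.support x).image Prod.fst)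
      fun p hp => Finset.mem_image_of_mem _ hp]
    refine Finset.sum_eq_zero fun b _ => ?_
    by_cases hb : b ∈ S
    · rw [← sum_branch_eq_zero f l hg hx b]
      refine Finset.sum_congr rfl fun p hp => ?_
      rw [if_pos (by rwa [(Finset.mem_filter.1 hp).2])]
    · refine Finset.sum_eq_zero fun p hp => ?_
      rw [if_neg (by rwa [(Finset.mem_filter.1 hp).2]), LinearMap.zero_apply]
  have hval : ∀ p (y : F p.2), (LinearMap.ker (treeMap f l)).liftQ φ hφ (treeIncl f l p y) =
      (if p.1 ∈ S then g p.2 else 0) y := fun p y =>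
    DirectSum.toModule_lof (φ := fun p : Set A × ι => if p.1 ∈ S then g p.2 else 0) R p y
  refine ⟨(LinearMap.ker (treeMap f l)).liftQ φ hφ, fun b hb i y => ?_, fun b hb i y => ?_⟩
  · rw [hval, if_pos hb]
  · rw [hval, if_neg hb, LinearMap.zero_apply]

theorem node_node {b : Set A} {i k : ι} (h : k ≤ i) :
    node l (Subtype.val '' {a : {a // l a < i} | a.1 ∈ b}) k = node l b k := by
  ext a
  simp only [node, Set.mem_ofPred_eq, Set.mem_image, Subtype.exists, exists_and_left,
    exists_prop, exists_eq_right_right]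
  exact ⟨fun h => ⟨h.1.1, h.2⟩, fun h' => ⟨⟨h'.1, h'.2.trans_le h⟩, h'.2⟩⟩

theorem chain_limit_mem {𝒳 : ModuleClass.{u, v} R}
    (hfree : ClosedUnderFree (Cardinal.aleph 1) 𝒳) (hsum : ClosedUnderDirectSums 𝒳)
    (hsummand : ClosedUnderDirectSummands 𝒳) (hpre : Precovering 𝒳)
    [WellFoundedLT ι] [Nonempty ι] [DirectedSystem (fun i => F i) fun i j h => f i j h]
    {C : ModuleCat.{v} R} {g : ∀ i, F i →ₗ[R] C} (hg : IsLimitCocone f g) (hF : ∀ i, 𝒳 (F i)) :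
    𝒳 C := by
  classical
  by_cases hmax : ∃ m : ι, ∀ i, i ≤ m
  · obtain ⟨m, hm⟩ := hmax
    exact hg.mem_of_top hsummand hm (hF m)
  have : NoMaxOrder ι := ⟨by simpa using hmax⟩
  obtain ⟨X, π, hX, hπ⟩ := hpre C
  obtain ⟨A, l, hκ, hl⟩ := exists_levels ι (max (max ℵ₀ #ι) (max #X #(Σ i, F i)))
  simp only [max_le_iff] at hκ
  obtain ⟨⟨hA, hιA⟩, hXA, hFA⟩ := hκ
  have hL : 𝒳 (ModuleCat.of R (TreeModule f l)) :=
    hfree _ (treeModule_isFreeRel f l hsum hsummand hF)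
  choose t ht ht' using exists_treeModule_map f l hg
  choose h hh using fun S => hπ _ hL (t S)
  have hh : ∀ S z, π (h S z) = t S z := fun S z => LinearMap.congr_fun (hh S) z
  -- Codes for truncated sections: a node at level `i` and an element of level at most `i`. The node
  -- itself serves as a branch through it.
  let G := Σ i, Set {a // l a < i} × (Σ j : {j // j ≤ i}, F j)
  let d : G → TreeModule f l := fun q =>
    treeIncl f l (Subtype.val '' q.2.1, q.2.2.1) q.2.2.2 -
      treeIncl f l (Subtype.val '' q.2.1, q.1) (f _ _ q.2.2.1.2 q.2.2.2)
  have hG : #G ≤ #A := by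
    rw [Cardinal.mk_sigma]
    refine (Cardinal.sum_le_sum _ (fun _ => #A) fun i => ?_).trans ?_
    · rw [Cardinal.mk_prod, Cardinal.lift_id, Cardinal.lift_id]
      refine (mul_le_mul' (hl i) (le_trans ?_ hFA)).trans_eq (Cardinal.mul_eq_self hA)
      exact Cardinal.mk_le_of_injective
        (f := fun y : (Σ j : {j // j ≤ i}, F j) => (⟨y.1, y.2⟩ : Σ i, F i)) (by
          rintro ⟨⟨j, hj⟩, y⟩ ⟨⟨j', hj'⟩, y'⟩ h
          simp only [Sigma.mk.injEq] at h
          obtain ⟨rfl, h⟩ := h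
          simpa using h)
    · rw [Cardinal.sum_const']
      exact (mul_le_mul' hιA le_rfl).trans_eq (Cardinal.mul_eq_self hA)
  obtain ⟨S, S', hSS', hne⟩ : ∃ S S' : Set (Set A), (∀ q, h S (d q) = h S' (d q)) ∧ S ≠ S' := by
    by_contra! H
    have hinj : Function.Injective fun (S : Set (Set A)) (q : G) => h S (d q) := fun S S' hS =>
      H S S' fun q => congrFun hS q
    have hle : #(G → X) ≤ 2 ^ #A := by
      -- `#X ^ #G ≤ #A ^ #A = 2 ^ #A`, too small for the `2 ^ 2 ^ #A` sets of branches.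
      rw [← Cardinal.power_def, ← Cardinal.power_self_eq hA]
      exact (Cardinal.power_le_power_right hXA).trans (Cardinal.power_le_power_left
        (Cardinal.aleph0_pos.trans_le hA).ne' hG)
    have := (Cardinal.mk_le_of_injective hinj).trans hle
    rw [Cardinal.mk_set, Cardinal.mk_set] at this
    exact this.not_gt (Cardinal.cantor _)
  obtain ⟨S, S', hSS', b, hb, hb'⟩ : ∃ S S' : Set (Set A), (∀ q, h S (d q) = h S' (d q)) ∧
      ∃ b, b ∈ S ∧ b ∉ S' := by
    by_cases hsub : S ⊆ S'
    · obtain ⟨b, hb, hb'⟩ := Set.not_subset.1 fun hsub' => hne (hsub.antisymm hsub')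
      exact ⟨S', S, fun q => (hSS' q).symm, b, hb, hb'⟩
    · obtain ⟨b, hb, hb'⟩ := Set.not_subset.1 hsub
      exact ⟨S, S', hSS', b, hb, hb'⟩
  obtain ⟨s, hs⟩ := hg.exists_desc (fun i => (h S - h S') ∘ₗ treeIncl f l (b, i)) (by
    intro i j hij x
    have hd := hSS' ⟨j, {a | a.1 ∈ b}, ⟨i, hij⟩, x⟩
    have hd' : d ⟨j, {a | a.1 ∈ b}, ⟨i, hij⟩, x⟩ =
        treeIncl f l (b, i) x - treeIncl f l (b, j) (f i j hij x) :=
      treeIncl_sub_eq f l hij (fun k hk => node_node l hk.le) x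
    rw [hd', ← sub_eq_zero, ← LinearMap.sub_apply, map_sub, sub_eq_zero] at hd
    exact hd.symm)
  -- On branch `b` the two maps to `C` are `g i` and zero, so `π ∘ s` is the identity.
  refine hsummand X C hX s π (LinearMap.ext fun c => ?_)
  obtain ⟨i, x, rfl⟩ := hg.surj c
  simp [hs, hh, ht S b hb, ht' S' b hb']

end Counting
-- Reduction of directed posets to well-ordered chains.
/-- In a directed order, upper bounds of the nonempty finite subsets can be chosen monotonically. -/
theorem exists_monotone_upperBound (ι : Type*) [Preorder ι] [IsDirectedOrder ι] [Nonempty ι] :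
    ∃ m : Finset ι → ι, (∀ s, ∀ i ∈ s, i ≤ m s) ∧ Monotone m := by
  classical
  have hb : ∀ s : Finset ι, ∃ k, ∀ i ∈ s, i ≤ k := fun s => s.exists_le
  choose b hb using hb
  let m : Finset ι → ι := Finset.strongInduction fun s ih =>
    b (s ∪ s.ssubsets.attach.image fun t => ih t.1 (Finset.mem_ssubsets.1 t.2))
  have hm : ∀ s, m s = b (s ∪ s.ssubsets.attach.image fun t => m t.1) := fun s =>
    Finset.strongInduction_eq _ s
  refine ⟨m, fun s i hi => ?_, fun s t hst => ?_⟩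
  · rw [hm]
    exact hb _ _ (Finset.mem_union_left _ hi)
  · obtain rfl | hst := hst.eq_or_ssubset
    · exact le_rfl
    · rw [hm t]
      exact hb _ _ (Finset.mem_union_right _
        (Finset.mem_image.2 ⟨⟨s, Finset.mem_ssubsets.2 hst⟩, Finset.mem_attach _ _, rfl⟩))

/-- An infinite directed order is covered, up to cofinality, by a well-ordered chain of directed
subsets of smaller cardinality. -/
theorem exists_chain_of_directed_subsets (ι : Type v) [Preorder ι] [IsDirectedOrder ι] [Infinite ι] :
    ∃ (J : Type v) (_ : LinearOrder J) (_ : WellFoundedLT J) (_ : Nonempty J) (s : J → Set ι),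
      Monotone s ∧ (∀ j, (s j).Nonempty) ∧ (∀ j, DirectedOn (· ≤ ·) (s j)) ∧
      (∀ j, #(s j) < #ι) ∧ ∀ i, ∃ j, ∃ k ∈ s j, i ≤ k := by
  classical
  obtain ⟨m, hm, hmono⟩ := exists_monotone_upperBound ι
  let J := (#ι).ord.ToType
  have hJ : #J = #ι := Cardinal.mk_ord_toType _
  obtain ⟨e⟩ := Cardinal.eq.1 hJ
  have hinf : ℵ₀ ≤ #ι := Cardinal.aleph0_le_mk ι
  have : Nonempty J := e.nonempty
  have hIic : ∀ j : J, #(Finset (Set.Iic j)) < #ι := by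
    intro j
    rcases finite_or_infinite (Set.Iic j) with h | h
    · exact (Cardinal.lt_aleph0_of_finite _).trans_le hinf
    · rw [Cardinal.mk_finset_of_infinite]
      rw [← Set.Iio_insert]
      have hIio : #(Set.Iio j) < #ι :=
        (Cardinal.mk_Iio_lt j (by simp [hJ, J])).trans_eq hJ
      refine (Cardinal.mk_insert_le).trans_lt ?_
      exact Cardinal.add_lt_of_lt hinf hIio
        (Cardinal.one_lt_aleph0.trans_le hinf)
  -- Chosen bounds of finite sets from an initial segment: monotonicity of `m` gives directedness,
  -- and proper initial segments of the initial ordinal of `#ι` are smaller than `ι`.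
  let s : J → Set ι := fun j =>
    {k | ∃ t : Finset J, t.Nonempty ∧ (∀ i ∈ t, i ≤ j) ∧ m (t.image e) = k}
  refine ⟨J, inferInstance, inferInstance, this, s, ?_, ?_, ?_, ?_, ?_⟩
  · rintro j j' hj _ ⟨t, ht, htj, rfl⟩
    exact ⟨t, ht, fun i hi => (htj i hi).trans hj, rfl⟩
  · exact fun j => ⟨_, {j}, Finset.singleton_nonempty j, by simp, rfl⟩
  · rintro j _ ⟨t, ht, htj, rfl⟩ _ ⟨t', ht', htj', rfl⟩
    refine ⟨_, ⟨t ∪ t', ht.mono Finset.subset_union_left, fun i hi => ?_, rfl⟩,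
      hmono (Finset.image_subset_image Finset.subset_union_left),
      hmono (Finset.image_subset_image Finset.subset_union_right)⟩
    exact (Finset.mem_union.1 hi).elim (htj i) (htj' i)
  · intro j
    refine lt_of_le_of_lt ?_ (hIic j)
    refine Cardinal.mk_le_of_surjective
      (f := fun t : {t : Finset (Set.Iic j) // t.Nonempty} =>
        (⟨m ((t.1.map (Function.Embedding.subtype _)).image e), _, t.2.map, by
          simp +contextual, rfl⟩ : s j)) ?_ |>.trans (Cardinal.mk_subtype_le _)
    rintro ⟨_, t, ht, htj, rfl⟩
    refine ⟨⟨t.subtype (· ∈ Set.Iic j), ?_⟩, ?_⟩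
    · obtain ⟨i, hi⟩ := ht
      exact ⟨⟨i, htj i hi⟩, by simpa using hi⟩
    · simp only [Subtype.mk.injEq]
      congr 2
      rw [Finset.subtype_map, Finset.filter_true_of_mem (p := (· ∈ Set.Iic j)) htj]
  · intro i
    exact ⟨e.symm i, _, ⟨{e.symm i}, Finset.singleton_nonempty _, by simp, rfl⟩,
      hm _ _ (by simp)⟩

/-- The limits over the smaller directed subsets lie in `𝒳` by induction, and they form a
well-ordered system with limit `C`. -/
theorem directed_limit_mem {R : Type u} [Ring R] {𝒳 : ModuleClass.{u, v} R}
    (hfree : ClosedUnderFree (Cardinal.aleph 1) 𝒳) (hsum : ClosedUnderDirectSums 𝒳)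
    (hsummand : ClosedUnderDirectSummands 𝒳) (hpre : Precovering 𝒳) (κ : Cardinal.{v}) :
    ∀ (ι : Type v) [PartialOrder ι] [IsDirectedOrder ι] [Nonempty ι] (_ : #ι = κ)
      (F : ι → ModuleCat.{v} R) (f : ∀ i j, i ≤ j → F i →ₗ[R] F j)
      [DirectedSystem (fun i => F i) fun i j h => f i j h]
      (C : ModuleCat.{v} R) (g : ∀ i, F i →ₗ[R] C) (_ : IsLimitCocone f g)
      (_ : ∀ i, 𝒳 (F i)), 𝒳 C := by
  classical
  induction κ using WellFoundedLT.induction with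
  | _ κ ih =>
  rintro ι _ _ _ rfl F f _ C g hg hF
  rcases finite_or_infinite ι with hfin | hinf
  · obtain ⟨m, hm⟩ := Finite.exists_le (id : ι → ι)
    exact hg.mem_of_top hsummand hm (hF m)
  obtain ⟨J, _, _, _, s, hs, hne, hdir, hcard, hcof⟩ := exists_chain_of_directed_subsets ι
  have hne' : ∀ j, Nonempty (s j) := fun j => (hne j).to_subtype
  have hdir' : ∀ j, IsDirectedOrder (s j) := fun j => ⟨(hdir j).directed_val⟩
  let fs : ∀ j, ∀ i k : s j, i ≤ k → F i →ₗ[R] F k := fun j i k h => f i k h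
  have hds : ∀ j, DirectedSystem (fun i : s j => F i) fun i k h => fs j i k h := fun j =>
    ⟨fun i x => DirectedSystem.map_self' (f := f) x,
      fun _ _ _ hij hjk x => DirectedSystem.map_map' (f := f) hij hjk x⟩
  let D : J → ModuleCat.{v} R := fun j =>
    ModuleCat.of R (Module.DirectLimit (fun i : s j => F i) (fs j))
  have hD : ∀ j, 𝒳 (D j) := fun j =>
    ih _ (hcard j) (s j) rfl (fun i => F i) (fs j) (D j) _ IsLimitCocone.directLimit fun i => hF i
  let o : ∀ j (i : s j), F i →ₗ[R] D j := fun j i =>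
    Module.DirectLimit.of R (s j) (fun i : s j => F i) (fs j) i
  have ho : ∀ j (z : D j), ∃ i x, o j i x = z := fun j z => Module.DirectLimit.exists_of z
  have hof : ∀ j (i k : s j) (h : i ≤ k) x, o j k (f i k h x) = o j i x := fun j i k h x =>
    Module.DirectLimit.of_f (f := fs j) (hij := h)
  let D' : ∀ j j', j ≤ j' → D j →ₗ[R] D j' := fun j j' h =>
    Module.DirectLimit.lift R (s j) (fun i : s j => F i) (fs j)
      (fun i => o j' ⟨i, hs h i.2⟩) fun i k hik x => hof j' ⟨i, hs h i.2⟩ ⟨k, hs h k.2⟩ hik x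
  have hD' : ∀ j j' (h : j ≤ j') (i : s j) x, D' j j' h (o j i x) = o j' ⟨i, hs h i.2⟩ x :=
    fun j j' h i x => Module.DirectLimit.lift_of ..
  let G : ∀ j, D j →ₗ[R] C := fun j =>
    Module.DirectLimit.lift R (s j) (fun i : s j => F i) (fs j) (fun i => g i)
      fun i k hik x => hg.comp i k hik x
  have hG : ∀ j (i : s j) x, G j (o j i x) = g i x := fun j i x => Module.DirectLimit.lift_of ..
  have : DirectedSystem (fun j => D j) fun i j h => D' i j h := by
    refine ⟨fun j z => ?_, fun j'' j' j h h' z => ?_⟩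
    · obtain ⟨i, x, rfl⟩ := ho _ z
      exact hD' j j le_rfl i x
    · obtain ⟨i, x, rfl⟩ := ho _ z
      simp only [hD']
  refine chain_limit_mem D' hfree hsum hsummand hpre (g := G) ⟨fun j j' h z => ?_, fun c => ?_,
    fun j z hz => ?_⟩ hD
  · obtain ⟨i, x, rfl⟩ := ho _ z
    rw [hD' j j' h, hG, hG]
  · obtain ⟨i, x, rfl⟩ := hg.surj c
    obtain ⟨j, k, hk, hik⟩ := hcof i
    exact ⟨j, o j ⟨k, hk⟩ (f i k hik x), by rw [hG]; exact hg.comp i k hik x⟩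
  · obtain ⟨i, x, rfl⟩ := ho _ z
    rw [hG] at hz
    obtain ⟨k, hik, hk⟩ := hg.exact _ _ hz
    obtain ⟨j', k', hk', hkk'⟩ := hcof k
    refine ⟨max j j', le_max_left _ _, ?_⟩
    rw [hD' j _ (le_max_left _ _), ← hof (max j j') _ ⟨k', hs (le_max_right _ _) hk'⟩ (hik.trans hkk'),
      ← DirectedSystem.map_map' (f := f) hik hkk', hk, map_zero, map_zero]

end ModuleClass

theorem mainTheorem4 {R : Type u} [Ring R] (𝒳 : ModuleClass.{u, v} R)
    (hfree : ModuleClass.ClosedUnderFree (Cardinal.aleph 1) 𝒳)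
    (hsum : ModuleClass.ClosedUnderDirectSums 𝒳)
    (hsummand : ModuleClass.ClosedUnderDirectSummands 𝒳) :
    (ModuleClass.Precovering 𝒳 → ModuleClass.ClosedUnderDirectLimits 𝒳) ∧
      (ModuleClass.Covering 𝒳 → ModuleClass.ClosedUnderDirectLimits 𝒳) := by
  have key : ModuleClass.Precovering 𝒳 → ModuleClass.ClosedUnderDirectLimits 𝒳 := by
    intro hpre ι _ _ _ F f _ hF
    classical
    exact ModuleClass.directed_limit_mem hfree hsum hsummand hpre _ ι rfl F f _ _
      ModuleClass.IsLimitCocone.directLimit hF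
  refine ⟨key, fun hcov => key fun M => ?_⟩
  obtain ⟨X, f, hf⟩ := hcov M
  exact ⟨X, f, hf.1⟩
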